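/- Let $X$ be the set of finite binary sequences, $|s|$ the length of $s\in X$, and $X^\infty$ the set of infinite binary sequences; for $\alpha\in X^\infty$ let $\alpha_n$ be its prefix of length $n$. A \emph{computer} is a partial recursive function $C\colon X\to X$ whose domain is prefix-free (no element of it is a prefix of another). Let $U$ be any optimal computer, that is, a computer such that for every computer $C$ there is a constant $\mathrm{sim}(C)$ such that for every $p\in\operatorname{dom} C$ there is $q$ with $U(q)=C(p)$ and $|q|\le|p|+\mathrm{sim}(C)$. Put $H(s)=\min\{|p| : U(p)=s\}$. Let $D\ge 0$ be a computable real number, meaning that the base-two expansion of its fractional part is given by a total recursive function, and let $\alpha\in X^\infty$. \begin{itemize} \item $\alpha$ is \emph{Chaitin $D$-random} if $\lim_{n\to\infty}\bigl(H(\alpha_n)-Dn\bigr)=\infty$. \item A \emph{Solovay $D$-test} is a recursively enumerable set $\mathcal T\subset\mathbb N\times X$ with $\sum_{(i,s)\in\mathcal T}2^{-D|s|}<\infty$. The sequence $\alpha$ is \emph{Solovay $D$-random} if for every Solovay $D$-test $\mathcal T$ there is $m\in\mathbb N$ such that for all $i>m$ no prefix of $\alpha$ belongs to $\mathcal T_i=\{s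 : (i,s)\in\mathcal T\}$. \end{itemize} Then $\alpha$ is Chaitin $D$-random if and only if $\alpha$ is Solovay $D$-random. -/

import Mathlib

/-!
Finite binary sequences are `List Bool`, infinite binary sequences are `ℕ → Bool`.
-/

namespace DRandom

/-- A set of finite binary sequences is prefix-free if no element of it is a prefix of another
element of it. -/
def PrefixFree (S : Set (List Bool)) : Prop :=
  ∀ p ∈ S, ∀ q ∈ S, p <+: q → p = q

/-- A computer is a partial recursive function from finite binary sequences to finite binary
sequences whose domain is prefix-free. -/
structure IsComputer (C : List Bool →. List Bool) : Prop where
  partrec : Partrec C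
  prefixFree : PrefixFree C.Dom

/-- An optimal computer: it simulates every computer, at the cost of at most a constant number of
additional program bits. -/
structure IsOptimalComputer (U : List Bool →. List Bool) : Prop where
  isComputer : IsComputer U
  simulates : ∀ C : List Bool →. List Bool, IsComputer C →
    ∃ sim : ℕ, ∀ p s : List Bool, s ∈ C p → ∃ q : List Bool, s ∈ U q ∧ q.length ≤ p.length + sim

/-- The program-size complexity of `s` relative to `C`: the least length of a program `p` with
`C p = s`, which is `⊤` if there is no such program. -/
noncomputable def complexity (C : List Bool →. List Bool) (s : List Bool) : ℕ∞ :=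
  ⨅ (p : List Bool) (_ : s ∈ C p), (p.length : ℕ∞)

/-- A real number is computable if the binary digits of its fractional part are given by a total
recursive function; `f n` is the digit of weight `2 ^ (-(n + 1))`. -/
def IsComputableReal (D : ℝ) : Prop :=
  ∃ f : ℕ → Bool, Computable f ∧
    HasSum (fun n : ℕ => if f n then ((1 : ℝ) / 2) ^ (n + 1) else 0) (Int.fract D)

/-- The prefix of length `n` of an infinite binary sequence. -/
def pre (α : ℕ → Bool) (n : ℕ) : List Bool :=
  (List.range n).map α

/-- The infinite binary sequences that have a prefix in `S`. -/
def cylinder (S : Set (List Bool)) : Set (ℕ → Bool) :=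
  {α | ∃ n : ℕ, pre α n ∈ S}

/-- Chaitin `D`-randomness, with respect to the complexity defined by `U`: the difference
`H(α_n) - D n` (taken in the extended reals, as `H` is `⊤` where there is no program) tends to
infinity. -/
def ChaitinRandom (U : List Bool →. List Bool) (D : ℝ) (α : ℕ → Bool) : Prop :=
  Filter.Tendsto
    (fun n : ℕ => (((complexity U (pre α n) : ℕ∞) : ENNReal) : EReal) - ((D * (n : ℝ) : ℝ) : EReal))
    Filter.atTop (nhds ⊤)

/-- A Solovay `D`-test: an r.e. set of pairs `(i, s)` over which the sum of `2 ^ (-D |s|)` is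
finite (the terms are positive, so this is summability). -/
structure IsSolovayTest (D : ℝ) (T : Set (ℕ × List Bool)) : Prop where
  re : REPred (fun x : ℕ × List Bool => x ∈ T)
  summable : Summable (fun x : T => (2 : ℝ) ^ (-D * ((x : ℕ × List Bool).2.length : ℝ)))

/-- Solovay `D`-randomness. -/
def SolovayRandom (D : ℝ) (α : ℕ → Bool) : Prop :=
  ∀ T : Set (ℕ × List Bool), IsSolovayTest D T →
    ∃ m : ℕ, ∀ i : ℕ, m < i → α ∉ cylinder {s : List Bool | (i, s) ∈ T}

end DRandom

/-! Chaitin randomness says that for every `K`, every program for a long enough prefix of length `n`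
is longer than `D * n + K` (`chaitinRandom_iff`). Finite weight and short programs are two sides of
Kraft's theorem.

If `α` is Chaitin random, read a Solovay test `T` as an r.e. list of requests to describe each `s`
in about `D |s|` bits. The total weight is finite, so Kraft–Chaitin (`exists_computer_of_summable`)
yields a computer meeting the requests up to a constant, and optimality transfers this to `U`. Hence
only finitely many prefixes of `α` occur in `T`. Each occurs at only finitely many indices, since
every occurrence adds the same positive term to a convergent sum.

Conversely, the strings `s` with a program of length at most about `D |s| + K`, indexed by their
length, form a test: they are r.e., and the Kraft inequality for the domain of `U` bounds their
weight. A Solovay random `α` eventually avoids them.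

Computability of `D` lets `D * n` be replaced by a computable integer at bounded distance, which
changes weights by a bounded factor and keeps everything effective. -/

namespace DRandom

open Computable Filter

/-! ### Finite stages and enumerations -/

/-- A partial recursive function is the limit of a computable sequence of finite stages. -/
theorem exists_stages {α σ : Type*} [Primcodable α] [Primcodable σ] {f : α →. σ}
    (hf : Partrec f) : ∃ g : α × ℕ → Option σ, Computable g ∧
      (∀ a k l, k ≤ l → (g (a, k)).isSome → (g (a, l)).isSome) ∧ (∀ a, g (a, 0) = none) ∧
      ∀ a b, b ∈ f a ↔ ∃ k, b ∈ g (a, k) := by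
  obtain ⟨c, hc⟩ := Nat.Partrec.Code.exists_code.1 hf
  have key : ∀ a n, n ∈ c.eval (Encodable.encode a) ↔ ∃ b ∈ f a, Encodable.encode b = n := by
    intro a n
    simp [hc]
  refine ⟨fun x => (c.evaln x.2 (Encodable.encode x.1)).bind Encodable.decode, ?_, ?_, ?_, ?_⟩
  · have h1 : Primrec fun x : α × ℕ => c.evaln x.2 (Encodable.encode x.1) :=
      Nat.Partrec.Code.primrec_evaln.comp
        (Primrec.pair (Primrec.pair Primrec.snd (Primrec.const c))
          (Primrec.encode.comp Primrec.fst))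
    exact (Primrec.option_bind h1 (Primrec.decode.comp Primrec.snd).to₂).to_comp
  · intro a k l hkl h
    obtain ⟨b, hb⟩ := Option.isSome_iff_exists.1 h
    obtain ⟨n, hn, hb⟩ := Option.bind_eq_some_iff.1 hb
    refine Option.isSome_iff_exists.2 ⟨b, Option.bind_eq_some_iff.2 ⟨n, ?_, hb⟩⟩
    exact Nat.Partrec.Code.evaln_mono hkl hn
  · intro a
    simp [Nat.Partrec.Code.evaln]
  · intro a b
    constructor
    · intro hb
      obtain ⟨k, hk⟩ := Nat.Partrec.Code.evaln_complete.1 ((key a _).2 ⟨b, hb, rfl⟩)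
      exact ⟨k, Option.bind_eq_some_iff.2 ⟨_, hk, by simp⟩⟩
    · rintro ⟨k, hk⟩
      obtain ⟨n, hn, hb⟩ := Option.bind_eq_some_iff.1 hk
      obtain ⟨b', hb', rfl⟩ := (key a n).1 (Nat.Partrec.Code.evaln_sound hn)
      simp only [Encodable.encodek, Option.some.injEq] at hb
      exact hb ▸ hb'

/-- A recursively enumerable set has a computable enumeration without repetition. -/
theorem exists_injective_enumeration {α : Type*} [Primcodable α] {T : Set α}
    (hT : REPred fun x => x ∈ T) : ∃ e : ℕ → Option α, Computable e ∧
      (∀ x, x ∈ T ↔ ∃ n, e n = some x) ∧ ∀ m n x, e m = some x → e n = some x → m = n := by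
  classical
  obtain ⟨g, hg, hmono, h0, hgT⟩ := exists_stages hT
  have hT' : ∀ x, x ∈ T ↔ ∃ k, (g (x, k)).isSome := by
    intro x
    have := hgT x ()
    simp only [Part.mem_assert_iff, Part.mem_some_iff, exists_prop, and_true] at this
    rw [this]
    exact exists_congr fun k => Option.isSome_iff_exists.trans
      ⟨fun ⟨u, hu⟩ => hu, fun hu => ⟨_, hu⟩⟩ |>.symm
  -- The index `n` codes a stage and a candidate. A candidate is emitted only when it is accepted at
  -- the next stage but not yet at this one; by monotonicity this happens at most once.
  let t : ℕ → α → Bool := fun n x =>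
    (g (x, n.unpair.1 + 1)).isSome && !(g (x, n.unpair.1)).isSome &&
      decide (Encodable.encode x = n.unpair.2)
  let e : ℕ → Option α := fun n =>
    (Encodable.decode (α := α) n.unpair.2).bind fun x => bif t n x then some x else none
  have he : ∀ n x, e n = some x ↔ t n x = true := by
    intro n x
    simp only [e, Option.bind_eq_some_iff]
    constructor
    · rintro ⟨y, -, hy⟩
      cases h : t n y
      · simp [h] at hy
      · simp only [h, cond_true, Option.some.injEq] at hy
        exact hy ▸ h
    · intro h
      refine ⟨x, ?_, by simp [h]⟩
      simp only [t, Bool.and_eq_true, decide_eq_true_eq] at h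
      simp [← h.2]
  have hst : ∀ n x, t n x = true ↔ (g (x, n.unpair.1 + 1)).isSome ∧
      ¬ (g (x, n.unpair.1)).isSome ∧ Encodable.encode x = n.unpair.2 := by
    intro n x
    simp [t, and_assoc]
  refine ⟨e, ?_, ?_, ?_⟩
  · have hk : Computable fun y : ℕ × α => y.1.unpair.1 :=
      (Primrec.fst.comp (Primrec.unpair.comp Primrec.fst)).to_comp
    have h1 : Computable fun y : ℕ × α => (g (y.2, y.1.unpair.1 + 1)).isSome :=
      Primrec.option_isSome.to_comp.comp (hg.comp (snd.pair (succ.comp hk)))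
    have h2 : Computable fun y : ℕ × α => !(g (y.2, y.1.unpair.1)).isSome :=
      Primrec.not.to_comp.comp (Primrec.option_isSome.to_comp.comp (hg.comp (snd.pair hk)))
    have h3 : Computable fun y : ℕ × α => decide (Encodable.encode y.2 = y.1.unpair.2) :=
      (Primrec.eq.decide.comp (Primrec.encode.comp Primrec.snd)
        (Primrec.snd.comp (Primrec.unpair.comp Primrec.fst))).to_comp
    have ht : Computable fun y : ℕ × α => t y.1 y.2 :=
      Primrec.and.to_comp.comp (Primrec.and.to_comp.comp h1 h2) h3
    refine Computable.option_bind
      ((Primrec.decode.comp (Primrec.snd.comp Primrec.unpair)).to_comp) ?_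
    exact Computable.cond ht (option_some.comp snd) (const none)
  · intro x
    rw [hT']
    simp only [he, hst]
    constructor
    · intro h
      -- Stage `0` accepts nothing, so the first accepting stage has a predecessor.
      have hpos : Nat.find h ≠ 0 := by
        intro hz
        have := Nat.find_spec h
        rw [hz, h0] at this
        simp at this
      obtain ⟨k, hk⟩ := Nat.exists_eq_succ_of_ne_zero hpos
      refine ⟨Nat.pair k (Encodable.encode x), ?_, ?_, by simp⟩
      · have := Nat.find_spec h
        rw [hk] at this
        simpa using this
      · simpa using Nat.find_min h (m := k) (by omega)
    · rintro ⟨n, hn, -⟩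
      exact ⟨_, hn⟩
  · intro m n x hm hn
    rw [he, hst] at hm hn
    have h1 : m.unpair.1 = n.unpair.1 := by
      by_contra hne
      rcases lt_or_gt_of_ne hne with h | h
      · exact hn.2.1 (hmono _ _ _ h hm.1)
      · exact hm.2.1 (hmono _ _ _ h hn.1)
    have h2 : m.unpair.2 = n.unpair.2 := hm.2.2.symm.trans hn.2.2
    rw [← Nat.pair_unpair m, ← Nat.pair_unpair n, h1, h2]

theorem rePred_exists {α β : Type*} [Primcodable α] [Primcodable β] {f : α × β → Bool}
    (hf : Computable f) : REPred fun a => ∃ b, f (a, b) = true := by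
  have h : Computable₂ fun (a : α) (n : ℕ) =>
      (Encodable.decode (α := β) n).bind fun b => bif f (a, b) then some b else none := by
    refine Computable.option_bind (Computable.decode.comp snd) ?_
    exact Computable.cond (hf.comp ((fst.comp fst).pair snd)) (option_some.comp snd) (const none)
  refine (Partrec.rfindOpt h).dom_re.of_eq fun a => ?_
  rw [Nat.rfindOpt_dom]
  constructor
  · rintro ⟨n, b, hb⟩
    obtain ⟨b', -, hb'⟩ := Option.bind_eq_some_iff.1 hb
    cases hc : f (a, b')
    · simp [hc] at hb'
    · exact ⟨b', hc⟩
  · rintro ⟨b, hb⟩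
    exact ⟨Encodable.encode b, b, by simp [hb]⟩

theorem computable_pow : Computable₂ fun a b : ℕ => a ^ b :=
  (Primrec₂.unpaired'.1 Nat.Primrec.pow).to_comp

/-! ### Binary words as dyadic intervals -/

/-- The number with binary expansion `p`, most significant bit first. -/
def binaryValue (p : List Bool) : ℕ :=
  p.foldl (fun v b => 2 * v + b.toNat) 0

theorem binaryValue_concat (p : List Bool) (b : Bool) :
    binaryValue (p ++ [b]) = 2 * binaryValue p + b.toNat := by
  simp [binaryValue]

theorem binaryValue_append_bounds (p q : List Bool) :
    binaryValue p * 2 ^ q.length ≤ binaryValue (p ++ q) ∧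
      binaryValue (p ++ q) + 1 ≤ (binaryValue p + 1) * 2 ^ q.length := by
  induction q using List.reverseRecOn with
  | nil => simp
  | append_singleton q b ih =>
    rw [← List.append_assoc, binaryValue_concat, List.length_append, List.length_singleton, pow_succ]
    have hb : b.toNat ≤ 1 := Bool.toNat_le b
    constructor <;> nlinarith [ih.1, ih.2]

theorem exists_binaryValue_eq (n m : ℕ) (h : m < 2 ^ n) :
    ∃ p : List Bool, p.length = n ∧ binaryValue p = m := by
  induction n generalizing m with
  | zero => exact ⟨[], rfl, by simp [binaryValue]; omega⟩
  | succ n ih =>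
    obtain ⟨p, hp, hv⟩ := ih (m / 2) (by rw [pow_succ] at h; omega)
    refine ⟨p ++ [decide (m % 2 = 1)], by simp [hp], ?_⟩
    rw [binaryValue_concat, hv]
    rcases Nat.mod_two_eq_zero_or_one m with h | h <;> simp [h] <;> omega

theorem computable_binaryValue : Computable binaryValue := by
  have h : Primrec fun b : Bool => b.toNat := Primrec.dom_finite _
  refine (Primrec.list_foldl (h := fun (_ : List Bool) (x : ℕ × Bool) => 2 * x.1 + x.2.toNat)
    Primrec.id (Primrec.const 0) ?_).to_comp
  exact (Primrec.nat_add.comp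
    (Primrec.nat_mul.comp (Primrec.const 2) (Primrec.fst.comp Primrec.snd))
    (h.comp (Primrec.snd.comp Primrec.snd))).to₂

/-- If `p` is a prefix of `q`, the dyadic interval of `q` lies inside that of `p`. -/
theorem dyadic_le_of_prefix {p q : List Bool} (h : p <+: q) :
    (binaryValue p : ℝ) / 2 ^ p.length ≤ binaryValue q / 2 ^ q.length ∧
      ((binaryValue q : ℝ) + 1) / 2 ^ q.length ≤ (binaryValue p + 1) / 2 ^ p.length := by
  obtain ⟨r, rfl⟩ := h
  obtain ⟨h1, h2⟩ := binaryValue_append_bounds p r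
  have h1' : (binaryValue p : ℝ) * 2 ^ r.length ≤ binaryValue (p ++ r) := by exact_mod_cast h1
  have h2' : (binaryValue (p ++ r) : ℝ) + 1 ≤ (binaryValue p + 1) * 2 ^ r.length := by
    exact_mod_cast h2
  have e : (2 : ℝ) ^ (p ++ r).length = 2 ^ p.length * 2 ^ r.length := by
    rw [List.length_append, pow_add]
  rw [e]
  constructor
  · rw [div_le_div_iff₀ (by positivity) (by positivity)]
    nlinarith [show (0 : ℝ) < 2 ^ p.length by positivity]
  · rw [div_le_div_iff₀ (by positivity) (by positivity)]
    nlinarith [show (0 : ℝ) < 2 ^ p.length by positivity]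

/-! ### Kraft–Chaitin: serving requests online -/

/-- The running sum `∑ i < n, 2 ^ (-(length of request i))`, as a pair `(x, k)` standing for
`x / 2 ^ k`. -/
def allocated (l : ℕ → Option ℕ) (n : ℕ) : ℕ × ℕ :=
  Nat.rec (0, 0)
    (fun i s => (l i).elim s fun k => (s.1 * 2 ^ k + 2 ^ s.2, s.2 + k)) n

/-- The value of the code word of length `k + 1` that serves request `n`. -/
def slot (l : ℕ → Option ℕ) (n k : ℕ) : ℕ :=
  (allocated l n).1 * 2 ^ (k + 1) / 2 ^ (allocated l n).2 + 1

noncomputable def allocatedReal (l : ℕ → Option ℕ) (n : ℕ) : ℝ :=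
  (allocated l n).1 / 2 ^ (allocated l n).2

theorem allocatedReal_succ (l : ℕ → Option ℕ) (n : ℕ) :
    allocatedReal l (n + 1) = allocatedReal l n + (l n).elim 0 fun k => (2 : ℝ)⁻¹ ^ k := by
  have h : allocated l (n + 1) = (l n).elim (allocated l n) fun k =>
    ((allocated l n).1 * 2 ^ k + 2 ^ (allocated l n).2, (allocated l n).2 + k) := rfl
  rw [allocatedReal, h]
  cases hl : l n with
  | none => simp [allocatedReal]
  | some k =>
    simp only [Option.elim_some, allocatedReal]
    push_cast
    rw [pow_add, inv_pow]
    field_simp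

theorem allocatedReal_eq_sum (l : ℕ → Option ℕ) (n : ℕ) :
    allocatedReal l n = ∑ i ∈ Finset.range n, (l i).elim 0 fun k => (2 : ℝ)⁻¹ ^ k := by
  induction n with
  | zero => simp [allocatedReal, allocated]
  | succ n ih => rw [Finset.sum_range_succ, ← ih, allocatedReal_succ]

theorem allocatedReal_mono (l : ℕ → Option ℕ) : Monotone (allocatedReal l) := by
  refine monotone_nat_of_le_succ fun n => ?_
  rw [allocatedReal_succ]
  cases l n <;> simp

/-- Request `n` owns the interval of length `2 ^ (-k)` starting at the running sum. The next point
of the grid of mesh `2 ^ (-(k + 1))` is at most half that length away, so a full grid cell still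
fits. This rounding is why code words have length `k + 1`. -/
theorem slot_bounds {l : ℕ → Option ℕ} {n k : ℕ} (h : l n = some k) :
    allocatedReal l n < (slot l n k : ℝ) / 2 ^ (k + 1) ∧
      ((slot l n k : ℝ) + 1) / 2 ^ (k + 1) ≤ allocatedReal l (n + 1) := by
  have hpos : 0 < 2 ^ (allocated l n).2 := by positivity
  have h1 : (allocated l n).1 * 2 ^ (k + 1) < slot l n k * 2 ^ (allocated l n).2 := by
    rw [slot, mul_comm _ (2 ^ (allocated l n).2)]
    exact Nat.lt_mul_div_succ _ hpos
  have h2 : slot l n k * 2 ^ (allocated l n).2 ≤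
      (allocated l n).1 * 2 ^ (k + 1) + 2 ^ (allocated l n).2 := by
    rw [slot, add_mul, one_mul]
    exact Nat.add_le_add_right (Nat.div_mul_le_self _ _) _
  have h1' : ((allocated l n).1 : ℝ) * 2 ^ (k + 1) < slot l n k * 2 ^ (allocated l n).2 := by
    exact_mod_cast h1
  have h2' : (slot l n k : ℝ) * 2 ^ (allocated l n).2 ≤
      (allocated l n).1 * 2 ^ (k + 1) + 2 ^ (allocated l n).2 := by exact_mod_cast h2
  constructor
  · rw [allocatedReal, div_lt_div_iff₀ (by positivity) (by positivity)]
    exact h1'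
  · rw [allocatedReal_succ, h, Option.elim_some, allocatedReal, inv_pow, div_add' _ _ _ (by positivity),
      div_le_div_iff₀ (by positivity) (by positivity)]
    have : (2 : ℝ) ^ (k + 1) = 2 * 2 ^ k := by ring
    have hk : ((2 : ℝ) ^ k)⁻¹ * 2 ^ k = 1 := inv_mul_cancel₀ (by positivity)
    have e : (((allocated l n).1 : ℝ) + ((2 : ℝ) ^ k)⁻¹ * 2 ^ (allocated l n).2) * 2 ^ (k + 1) =
        (allocated l n).1 * 2 ^ (k + 1) + 2 * 2 ^ (allocated l n).2 := by
      rw [this]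
      linear_combination 2 * 2 ^ (allocated l n).2 * hk
    rw [e]
    linarith

theorem computable_allocated {l : ℕ → Option ℕ} (hl : Computable l) : Computable (allocated l) := by
  refine Computable.nat_rec (f := fun n : ℕ => n) (g := fun _ => ((0, 0) : ℕ × ℕ))
    (h := fun _ x => (l x.1).elim x.2 fun k => (x.2.1 * 2 ^ k + 2 ^ x.2.2, x.2.2 + k))
    Computable.id (const _) ?_
  have hx : Computable fun y : ℕ × ℕ × ℕ × ℕ => y.2.2 := snd.comp snd
  have : Computable fun y : ℕ × ℕ × ℕ × ℕ => Option.casesOn (motive := fun _ => ℕ × ℕ) (l y.2.1)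
      y.2.2 (fun k => (y.2.2.1 * 2 ^ k + 2 ^ y.2.2.2, y.2.2.2 + k)) := by
    refine Computable.option_casesOn (hl.comp (fst.comp snd)) hx ?_
    have hx' : Computable fun y : (ℕ × ℕ × ℕ × ℕ) × ℕ => y.1.2.2 := hx.comp fst
    have h1 : Computable fun y : (ℕ × ℕ × ℕ × ℕ) × ℕ => 2 ^ y.2 :=
      computable_pow.comp (const 2) snd
    have h2 : Computable fun y : (ℕ × ℕ × ℕ × ℕ) × ℕ => 2 ^ y.1.2.2.2 :=
      computable_pow.comp (const 2) (snd.comp hx')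
    have h3 : Computable fun y : (ℕ × ℕ × ℕ × ℕ) × ℕ => y.1.2.2.1 * 2 ^ y.2 :=
      Primrec.nat_mul.to_comp.comp (fst.comp hx') h1
    have h4 : Computable fun y : (ℕ × ℕ × ℕ × ℕ) × ℕ => y.1.2.2.1 * 2 ^ y.2 + 2 ^ y.1.2.2.2 :=
      Primrec.nat_add.to_comp.comp h3 h2
    have h5 : Computable fun y : (ℕ × ℕ × ℕ × ℕ) × ℕ => y.1.2.2.2 + y.2 :=
      Primrec.nat_add.to_comp.comp (snd.comp hx') snd
    exact (h4.pair h5).to₂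
  refine this.of_eq fun y => ?_
  cases h : l y.2.1 <;> simp [h]

theorem computable_slot {l : ℕ → Option ℕ} (hl : Computable l) :
    Computable₂ (slot l) := by
  have ha : Computable fun x : ℕ × ℕ => allocated l x.1 := (computable_allocated hl).comp fst
  have h1 : Computable fun x : ℕ × ℕ => 2 ^ (x.2 + 1) :=
    computable_pow.comp (const 2) (succ.comp snd)
  have h2 : Computable fun x : ℕ × ℕ => 2 ^ (allocated l x.1).2 :=
    computable_pow.comp (const 2) (snd.comp ha)
  exact succ.comp (Primrec.nat_div.to_comp.comp (Primrec.nat_mul.to_comp.comp (fst.comp ha) h1) h2)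

/-- The **Kraft–Chaitin theorem** for an enumerated list of requests: a computer serves every
request `(s, k)` with a program for `s` of length `k + 1`. -/
theorem exists_computer_of_requests {r : ℕ → Option (List Bool × ℕ)} (hr : Computable r)
    (hsum : ∀ n, ∑ i ∈ Finset.range n, (r i).elim 0 (fun x => (2 : ℝ)⁻¹ ^ x.2) ≤ 1) :
    ∃ C, IsComputer C ∧ ∀ n s k, r n = some (s, k) → ∃ p, s ∈ C p ∧ p.length = k + 1 := by
  let l : ℕ → Option ℕ := fun n => (r n).map Prod.snd
  have hl : Computable l := Computable.option_map hr (snd.comp snd).to₂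
  have hlr : ∀ {n s k}, r n = some (s, k) → l n = some k := fun h => by simp [l, h]
  have hle : ∀ n, allocatedReal l n ≤ 1 := by
    intro n
    rw [allocatedReal_eq_sum]
    refine le_trans (le_of_eq (Finset.sum_congr rfl fun i _ => ?_)) (hsum n)
    cases h : r i <;> simp [l, h]
  let t : List Bool → ℕ → ℕ → Bool := fun p n k =>
    decide (p.length = k + 1) && decide (binaryValue p = slot l n k)
  have ht : ∀ p n k, t p n k = true ↔ p.length = k + 1 ∧ binaryValue p = slot l n k := by
    intro p n k
    simp [t]
  let c : List Bool → ℕ → Option (List Bool) := fun p n =>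
    (r n).bind fun x => bif t p n x.2 then some x.1 else none
  have hc : ∀ p n s, s ∈ c p n ↔ ∃ k, r n = some (s, k) ∧ p.length = k + 1 ∧
      binaryValue p = slot l n k := by
    intro p n s
    simp only [c, Option.mem_def, Option.bind_eq_some_iff]
    constructor
    · rintro ⟨⟨s', k⟩, hx, hy⟩
      cases h : t p n k
      · simp [h] at hy
      · simp only [h, cond_true, Option.some.injEq] at hy
        exact ⟨k, hy ▸ hx, (ht _ _ _).1 h⟩
    · rintro ⟨k, hx, hy⟩
      exact ⟨(s, k), hx, by simp [(ht _ _ _).2 hy]⟩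
  have hcomp : Computable₂ c := by
    refine Computable.option_bind (hr.comp snd) ?_
    have hn : Computable fun y : (List Bool × ℕ) × (List Bool × ℕ) => y.1.2 := snd.comp fst
    have hk : Computable fun y : (List Bool × ℕ) × (List Bool × ℕ) => y.2.2 := snd.comp snd
    have h1 : Computable fun y : (List Bool × ℕ) × (List Bool × ℕ) =>
        decide (y.1.1.length = y.2.2 + 1) :=
      Computable₂.comp (f := fun a b : ℕ => decide (a = b)) Primrec.eq.decide.to_comp
        (list_length.comp (fst.comp fst)) (succ.comp hk)
    have h2 : Computable fun y : (List Bool × ℕ) × (List Bool × ℕ) =>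
        decide (binaryValue y.1.1 = slot l y.1.2 y.2.2) :=
      Computable₂.comp (f := fun a b : ℕ => decide (a = b)) Primrec.eq.decide.to_comp
        (computable_binaryValue.comp (fst.comp fst)) ((computable_slot hl).comp hn hk)
    exact Computable.cond (Primrec.and.to_comp.comp h1 h2) (option_some.comp (fst.comp snd))
      (const none)
  -- Different requests own successive intervals, and the later cell starts strictly after its left
  -- end; a prefix relation would nest the two cells.
  have hdisj : ∀ {p q m n s s' k k'}, m < n → r m = some (s, k) → r n = some (s', k') →
      p.length = k + 1 → binaryValue p = slot l m k → q.length = k' + 1 →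
      binaryValue q = slot l n k' → ¬ p <+: q ∧ ¬ q <+: p := by
    intro p q m n s s' k k' hmn hm hn hp hpv hq hqv
    have h1 := (slot_bounds (hlr hm)).2
    have h2 := (slot_bounds (hlr hn)).1
    rw [← hp, ← hpv] at h1
    rw [← hq, ← hqv] at h2
    have h3 : allocatedReal l (m + 1) ≤ allocatedReal l n := allocatedReal_mono l hmn
    have h4 : (binaryValue p : ℝ) / 2 ^ p.length ≤ (binaryValue p + 1) / 2 ^ p.length := by
      gcongr; simp
    have h5 : (binaryValue q : ℝ) / 2 ^ q.length ≤ (binaryValue q + 1) / 2 ^ q.length := by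
      gcongr; simp
    constructor <;> intro h
    · have := (dyadic_le_of_prefix h).2
      linarith
    · have := (dyadic_le_of_prefix h).1
      linarith
  have huniq : ∀ {p q m n s s' }, s ∈ c p m → s' ∈ c q n → p <+: q → m = n := by
    intro p q m n s s' h h' hpq
    obtain ⟨k, h1, h2, h3⟩ := (hc _ _ _).1 h
    obtain ⟨k', h1', h2', h3'⟩ := (hc _ _ _).1 h'
    by_contra hne
    rcases lt_or_gt_of_ne hne with hlt | hlt
    · exact (hdisj hlt h1 h1' h2 h3 h2' h3').1 hpq
    · exact (hdisj hlt h1' h1 h2' h3' h2 h3).2 hpq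
  refine ⟨fun p => Nat.rfindOpt (c p), ⟨Partrec.rfindOpt hcomp, ?_⟩, ?_⟩
  · intro p hp q hq hpq
    obtain ⟨m, s, hm⟩ := Nat.rfindOpt_dom.1 hp
    obtain ⟨n, s', hn⟩ := Nat.rfindOpt_dom.1 hq
    obtain rfl := huniq hm hn hpq
    obtain ⟨k, h1, h2, -⟩ := (hc _ _ _).1 hm
    obtain ⟨k', h1', h2', -⟩ := (hc _ _ _).1 hn
    rw [h1] at h1'
    simp only [Option.some.injEq, Prod.mk.injEq] at h1'
    exact hpq.eq_of_length (by omega)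
  · intro n s k h
    -- As the total weight is at most `1`, the cell lies in the unit interval and is that of an
    -- actual word.
    have hlt : slot l n k < 2 ^ (k + 1) := by
      have h1 := (slot_bounds (hlr h)).2.trans (hle _)
      rw [div_le_one (by positivity)] at h1
      exact_mod_cast h1
    obtain ⟨p, hp, hv⟩ := exists_binaryValue_eq _ _ hlt
    have hs : s ∈ c p n := (hc _ _ _).2 ⟨k, h, hp, hv⟩
    -- The search might stop at another request; `huniq` applied to `p` and itself excludes this.
    obtain ⟨s', hs'⟩ := Part.dom_iff_mem.1 (Nat.rfindOpt_dom.2 ⟨n, s, hs⟩)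
    obtain ⟨m, hm⟩ := Nat.rfindOpt_spec hs'
    obtain rfl := huniq hm hs List.prefix_rfl
    exact ⟨p, Option.mem_unique hm hs ▸ hs', hp⟩

theorem sum_enumeration_le {α : Type*} {T : Set α} {e : ℕ → Option α}
    (heT : ∀ n x, e n = some x → x ∈ T)
    (hinj : ∀ m n x, e m = some x → e n = some x → m = n) {u : α → ℝ} (hu : ∀ x, 0 ≤ u x)
    (hs : Summable fun x : T => u x) (n : ℕ) :
    ∑ i ∈ Finset.range n, (e i).elim 0 u ≤ ∑' x : T, u x := by
  classical
  have hd : Set.PairwiseDisjoint (Finset.range n : Set ℕ) fun i => (e i).toFinset := by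
    intro i _ j _ hij
    refine Finset.disjoint_left.2 fun x hi hj => hij (hinj i j x ?_ ?_)
    · simpa using hi
    · simpa using hj
  have h1 : ∑ i ∈ Finset.range n, (e i).elim 0 u =
      ∑ x ∈ (Finset.range n).biUnion fun i => (e i).toFinset, u x := by
    rw [Finset.sum_biUnion hd]
    refine Finset.sum_congr rfl fun i _ => ?_
    cases e i <;> simp
  have h2 : ∀ x ∈ (Finset.range n).biUnion fun i => (e i).toFinset, x ∈ T := by
    intro x hx
    obtain ⟨i, -, hi⟩ := Finset.mem_biUnion.1 hx
    exact heT i x (by simpa using hi)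
  rw [h1, ← Finset.sum_subtype_of_mem u h2]
  exact hs.sum_le_tsum _ fun x _ => hu x

/-- The **Kraft–Chaitin theorem** for a recursively enumerable family of requests whose weights
have a finite sum. -/
theorem exists_computer_of_summable {α : Type*} [Primcodable α] {T : Set α}
    (hT : REPred fun x => x ∈ T) {s : α → List Bool} (hs : Computable s) {l : α → ℕ}
    (hl : Computable l) (hsum : Summable fun x : T => (2 : ℝ)⁻¹ ^ l x) :
    ∃ C, IsComputer C ∧ ∃ c, ∀ x ∈ T, ∃ p, s x ∈ C p ∧ p.length ≤ l x + c := by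
  obtain ⟨e, he, heT, hinj⟩ := exists_injective_enumeration hT
  -- Lengthening every request by `c` divides the total weight by `2 ^ c`, bringing it below `1`.
  obtain ⟨c, hc⟩ := pow_unbounded_of_one_lt (∑' x : T, (2 : ℝ)⁻¹ ^ l x) one_lt_two
  have hr : Computable fun n => (e n).map fun x => (s x, l x + c) :=
    Computable.option_map he ((hs.comp snd).pair
      (Primrec.nat_add.to_comp.comp (hl.comp snd) (const c))).to₂
  obtain ⟨C, hC, hp⟩ := exists_computer_of_requests hr fun n => by
    have h1 := sum_enumeration_le (fun n x h => (heT x).2 ⟨n, h⟩) hinj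
      (u := fun x => (2 : ℝ)⁻¹ ^ l x) (fun x => by positivity) hsum n
    have h2 : ∑ i ∈ Finset.range n, ((e i).map fun x => (s x, l x + c)).elim 0
        (fun x => (2 : ℝ)⁻¹ ^ x.2) =
        (∑ i ∈ Finset.range n, (e i).elim 0 fun x => (2 : ℝ)⁻¹ ^ l x) * 2⁻¹ ^ c := by
      rw [Finset.sum_mul]
      refine Finset.sum_congr rfl fun i _ => ?_
      cases e i <;> simp [pow_add, mul_comm]
    rw [h2, inv_pow, ← div_eq_mul_inv, div_le_one (by positivity)]
    exact h1.trans hc.le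
  refine ⟨C, hC, c + 1, fun x hx => ?_⟩
  obtain ⟨n, hn⟩ := (heT x).1 hx
  obtain ⟨p, hsp, hlp⟩ := hp n (s x) (l x + c) (by simp [hn])
  exact ⟨p, hsp, by omega⟩

/-! ### Kraft inequality for prefix-free sets -/

/-- The first words of two equal concatenations are prefixes of one word, hence comparable, hence
equal; cancel and recurse. The empty word is excluded because it can be inserted freely. -/
theorem PrefixFree.uniquelyDecodable {S : Set (List Bool)} (h : PrefixFree S) (hnil : [] ∉ S) :
    InformationTheory.UniquelyDecodable S := by
  intro L₁
  induction L₁ with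
  | nil =>
    intro L₂ _ h₂ hL
    cases L₂ with
    | nil => rfl
    | cons b L₂ =>
      have hb : b = [] := by
        simp only [List.flatten_nil, List.flatten_cons] at hL
        exact (List.append_eq_nil_iff.1 hL.symm).1
      exact absurd (hb ▸ h₂ b (by simp)) hnil
  | cons a L₁ ih =>
    intro L₂ h₁ h₂ hL
    cases L₂ with
    | nil =>
      have ha : a = [] := by
        simp only [List.flatten_nil, List.flatten_cons] at hL
        exact (List.append_eq_nil_iff.1 hL).1
      exact absurd (ha ▸ h₁ a (by simp)) hnil
    | cons b L₂ =>
      simp only [List.flatten_cons] at hL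
      have hab : a = b := by
        have ha : a <+: b ++ L₂.flatten := hL ▸ List.prefix_append _ _
        rcases List.prefix_or_prefix_of_prefix ha (List.prefix_append b _) with hp | hp
        · exact h a (h₁ a (by simp)) b (h₂ b (by simp)) hp
        · exact (h b (h₂ b (by simp)) a (h₁ a (by simp)) hp).symm
      subst hab
      rw [ih L₂ (fun w hw => h₁ w (by simp [hw])) (fun w hw => h₂ w (by simp [hw]))
        (List.append_cancel_left hL)]

/-- The **Kraft inequality**. -/
theorem PrefixFree.sum_le_one {S : Set (List Bool)} (h : PrefixFree S) (F : Finset (List Bool))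
    (hF : ↑F ⊆ S) : ∑ p ∈ F, (2 : ℝ)⁻¹ ^ p.length ≤ 1 := by
  have hF' : PrefixFree (F : Set (List Bool)) := fun p hp q hq => h p (hF hp) q (hF hq)
  by_cases hnil : [] ∈ F
  · have : F = {[]} := Finset.eq_singleton_iff_unique_mem.2
      ⟨hnil, fun q hq => (hF' [] hnil q hq List.nil_prefix).symm⟩
    simp [this]
  · simpa using InformationTheory.kraft_mcmillan_inequality (hF'.uniquelyDecodable hnil)

theorem PrefixFree.summable {S : Set (List Bool)} (h : PrefixFree S) :
    Summable fun p : S => (2 : ℝ)⁻¹ ^ (p : List Bool).length := by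
  refine summable_of_sum_le (c := 1) (fun p => by positivity) fun F => ?_
  have := h.sum_le_one (F.map (Function.Embedding.subtype _)) (by
    intro p hp
    obtain ⟨q, -, rfl⟩ := Finset.mem_map.1 hp
    exact q.2)
  simpa using this

/-! ### Integer approximation of `D * n` -/

theorem IsComputableReal.exists_computable_approx {D : ℝ} (hD : IsComputableReal D)
    (h0 : 0 ≤ D) :
    ∃ g : ℕ → ℕ, Computable g ∧ ∀ n, (g n : ℝ) ≤ D * n ∧ D * n ≤ g n + 2 := by
  obtain ⟨f, hf, hsum⟩ := hD
  obtain ⟨a, ha0, ha, hacomp⟩ : ∃ a : ℕ → ℕ, a 0 = 0 ∧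
      (∀ n, a (n + 1) = 2 * a n + (f n).toNat) ∧ Computable a := by
    refine ⟨fun n => Nat.rec 0 (fun i v => 2 * v + (f i).toNat) n, rfl, fun n => rfl, ?_⟩
    have hb : Primrec fun b : Bool => b.toNat := Primrec.dom_finite _
    refine Computable.nat_rec (f := fun n : ℕ => n) (g := fun _ => 0)
      (h := fun _ x => 2 * x.2 + (f x.1).toNat) Computable.id (const _) ?_
    have h1 : Computable fun y : ℕ × ℕ × ℕ => 2 * y.2.2 :=
      Primrec.nat_mul.to_comp.comp (const 2) (snd.comp snd)
    have h2 : Computable fun y : ℕ × ℕ × ℕ => (f y.2.1).toNat :=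
      hb.to_comp.comp (hf.comp (fst.comp snd))
    have h3 : Computable fun y : ℕ × ℕ × ℕ => 2 * y.2.2 + (f y.2.1).toNat :=
      Primrec.nat_add.to_comp.comp h1 h2
    exact h3.to₂
  let d : ℕ → ℝ := fun n => if f n then ((1 : ℝ) / 2) ^ (n + 1) else 0
  have hd0 : ∀ n, 0 ≤ d n := fun n => by simp only [d]; split_ifs <;> positivity
  have hd1 : ∀ n, d n ≤ ((1 : ℝ) / 2) ^ (n + 1) := fun n => by
    simp only [d]; split_ifs
    · exact le_rfl
    · positivity
  have hpart : ∀ n : ℕ, ∑ i ∈ Finset.range n, d i = (a n : ℝ) / 2 ^ n := by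
    intro n
    induction n with
    | zero => simp [ha0]
    | succ n ih =>
      rw [Finset.sum_range_succ, ih, ha]
      cases h : f n <;> simp [d, h, pow_succ] <;> field_simp
  have htail : ∀ n, ∑' i, d (i + n) ≤ 1 / 2 ^ n := by
    intro n
    have hg : HasSum (fun i : ℕ => ((1 : ℝ) / 2) ^ (i + n + 1)) (1 / 2 ^ n) := by
      have := hasSum_geometric_two.mul_left (((1 : ℝ) / 2) ^ (n + 1))
      have h1 : (fun i : ℕ => ((1 : ℝ) / 2) ^ (n + 1) * (1 / 2) ^ i) =
          fun i => (1 / 2) ^ (i + n + 1) := by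
        funext i; ring
      have h2 : ((1 : ℝ) / 2) ^ (n + 1) * 2 = 1 / 2 ^ n := by
        rw [pow_succ, div_pow, one_pow]; ring
      rwa [h1, h2] at this
    rw [← hg.tsum_eq]
    exact Summable.tsum_le_tsum (fun i => hd1 _) ((summable_nat_add_iff n).2 hsum.summable)
      hg.summable
  have hfr : ∀ n, (a n : ℝ) / 2 ^ n ≤ Int.fract D ∧ Int.fract D ≤ (a n : ℝ) / 2 ^ n + 1 / 2 ^ n := by
    intro n
    have h1 := hsum.summable.sum_add_tsum_nat_add n
    rw [hsum.tsum_eq] at h1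
    have h1 : (a n : ℝ) / 2 ^ n + ∑' i, d (i + n) = Int.fract D := by rw [← hpart]; exact h1
    have h2 : 0 ≤ ∑' i, d (i + n) := tsum_nonneg fun i => hd0 _
    have h3 := htail n
    constructor <;> linarith
  -- Keeping `n` digits of the fractional part costs at most `n / 2 ^ n ≤ 1`, and the integer
  -- division at most `1` more: hence the error bound `2`.
  refine ⟨fun n => ⌊D⌋₊ * n + n * a n / 2 ^ n, ?_, fun n => ?_⟩
  · have h1 : Computable fun n : ℕ => ⌊D⌋₊ * n :=
      Primrec.nat_mul.to_comp.comp (const _) Computable.id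
    have h2 : Computable fun n : ℕ => n * a n := Primrec.nat_mul.to_comp.comp Computable.id hacomp
    have h3 : Computable fun n : ℕ => 2 ^ n := computable_pow.comp (const 2) Computable.id
    have h4 : Computable fun n : ℕ => n * a n / 2 ^ n := Primrec.nat_div.to_comp.comp h2 h3
    exact Primrec.nat_add.to_comp.comp h1 h4
  · have hDn : D * n = ⌊D⌋₊ * n + Int.fract D * n := by
      have : D = ⌊D⌋₊ + Int.fract D := by
        rw [natCast_floor_eq_intCast_floor h0]
        exact (Int.floor_add_fract D).symm
      nth_rewrite 1 [this]
      ring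
    have hq1 : ((n * a n / 2 ^ n : ℕ) : ℝ) ≤ n * (a n / 2 ^ n) := by
      have := Nat.cast_div_le (α := ℝ) (m := n * a n) (n := 2 ^ n)
      push_cast at this
      rwa [mul_div_assoc] at this
    have hq2 : (n : ℝ) * (a n / 2 ^ n) ≤ (n * a n / 2 ^ n : ℕ) + 1 := by
      have h := (Nat.lt_mul_div_succ (n * a n) (show 0 < 2 ^ n by positivity)).le
      have h' : (n : ℝ) * a n ≤ 2 ^ n * ((n * a n / 2 ^ n : ℕ) + 1) := by exact_mod_cast h
      rw [← mul_div_assoc, div_le_iff₀ (by positivity)]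
      linarith
    have hn : (n : ℝ) * (1 / 2 ^ n) ≤ 1 := by
      rw [mul_one_div, div_le_one (by positivity)]
      exact_mod_cast (Nat.lt_two_pow_self (n := n)).le
    have hn0 : (0 : ℝ) ≤ n := Nat.cast_nonneg n
    have h1 := mul_le_mul_of_nonneg_right (hfr n).1 hn0
    have h2 := mul_le_mul_of_nonneg_right (hfr n).2 hn0
    rw [hDn]
    push_cast
    constructor <;> linarith

/-! ### Chaitin randomness in terms of programs -/

theorem coe_natCast_ereal (n : ℕ) : (((n : ℕ∞) : ENNReal) : EReal) = ((n : ℝ) : EReal) := by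
  rw [ENat.toENNReal_coe, ← ENNReal.ofReal_natCast, EReal.coe_ennreal_ofReal,
    max_eq_left n.cast_nonneg]

theorem lt_complexity_iff {C : List Bool →. List Bool} {s : List Bool} {r : ℝ} :
    (r : EReal) < ((complexity C s : ENNReal) : EReal) ↔ ∀ p, s ∈ C p → r < p.length := by
  constructor
  · intro h p hp
    have h1 : complexity C s ≤ (p.length : ℕ∞) := iInf₂_le p hp
    have h2 : ((complexity C s : ENNReal) : EReal) ≤ (((p.length : ℕ∞) : ENNReal) : EReal) := by
      exact_mod_cast h1
    have h3 := h.trans_le h2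
    rw [coe_natCast_ereal] at h3
    exact EReal.coe_lt_coe_iff.1 h3
  · intro h
    cases hc : complexity C s with
    | top => simp
    | coe n =>
      by_contra hn
      rw [coe_natCast_ereal, EReal.coe_lt_coe_iff, not_lt] at hn
      -- Program lengths are integers, so strict bounds on all of them survive the infimum.
      have h1 : ((n + 1 : ℕ) : ℕ∞) ≤ complexity C s := by
        refine le_iInf₂ fun p hp => ?_
        have : (n : ℝ) < p.length := hn.trans_lt (h p hp)
        exact_mod_cast this
      rw [hc] at h1
      have : n + 1 ≤ n := by exact_mod_cast h1
      omega

theorem chaitinRandom_iff {U : List Bool →. List Bool} {D : ℝ} {α : ℕ → Bool} :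
    ChaitinRandom U D α ↔
      ∀ K : ℕ, ∀ᶠ n : ℕ in atTop, ∀ p, pre α n ∈ U p → D * n + K < p.length := by
  have key : ∀ (x : ℝ) (n : ℕ), ((x : EReal) <
      ((complexity U (pre α n) : ENNReal) : EReal) - ((D * (n : ℝ) : ℝ) : EReal)) ↔
      ∀ p, pre α n ∈ U p → D * n + x < p.length := by
    intro x n
    rw [← lt_complexity_iff, EReal.lt_sub_iff_add_lt (by simp) (by simp), ← EReal.coe_add, add_comm]
  rw [ChaitinRandom, EReal.tendsto_nhds_top_iff_real]
  simp only [key]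
  constructor
  · intro h K
    exact h K
  · intro h x
    obtain ⟨K, hK⟩ := exists_nat_ge x
    filter_upwards [h K] with n hn p hp
    linarith [hn p hp]

theorem pre_length (α : ℕ → Bool) (n : ℕ) : (pre α n).length = n := by
  simp [pre]

theorem two_rpow_neg_natCast (n : ℕ) : (2 : ℝ) ^ (-(n : ℝ)) = 2⁻¹ ^ n := by
  rw [Real.rpow_neg two_pos.le, Real.rpow_natCast, inv_pow]

/-! ### The two implications -/

theorem ChaitinRandom.solovayRandom {U : List Bool →. List Bool} (hU : IsOptimalComputer U)
    {D : ℝ} (hDcomp : IsComputableReal D) (hD : 0 ≤ D) {α : ℕ → Bool}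
    (h : ChaitinRandom U D α) : SolovayRandom D α := by
  rw [chaitinRandom_iff] at h
  intro T hT
  obtain ⟨g, hg, hgD⟩ := hDcomp.exists_computable_approx hD
  have hsum : Summable fun x : T => (2 : ℝ)⁻¹ ^ g (x : ℕ × List Bool).2.length := by
    -- The error `2` in the exponent costs the factor `4`.
    refine Summable.of_nonneg_of_le (fun x => by positivity) (fun x => ?_)
      (hT.summable.mul_left 4)
    have h4 : (4 : ℝ) = 2 ^ (2 : ℝ) := by norm_num
    rw [← two_rpow_neg_natCast, h4, ← Real.rpow_add two_pos]
    refine Real.rpow_le_rpow_of_exponent_le one_le_two ?_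
    linarith [(hgD (x : ℕ × List Bool).2.length).2]
  obtain ⟨C, hC, c, hc⟩ := exists_computer_of_summable hT.re snd
    (hg.comp (list_length.comp snd)) hsum
  obtain ⟨k, hk⟩ := hU.simulates C hC
  obtain ⟨N, hN⟩ := eventually_atTop.1 (h (c + k))
  have hshort : ∀ i n, (i, pre α n) ∈ T → n < N := by
    intro i n hin
    by_contra hn
    obtain ⟨p, hp, hpl⟩ := hc _ hin
    obtain ⟨q, hq, hql⟩ := hk _ _ hp
    have h1 := hN n (not_lt.1 hn) q hq
    have h2 := (hgD n).1
    simp only [pre_length] at hpl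
    have h3 : (q.length : ℝ) ≤ g n + c + k := by exact_mod_cast hql.trans (by omega)
    push_cast at h1
    linarith
  have hfin : ∀ s : List Bool, {i | (i, s) ∈ T}.Finite := by
    intro s
    by_contra hinf
    have : Infinite {i | (i, s) ∈ T} := Set.infinite_coe_iff.2 hinf
    have hinj : Function.Injective fun i : {i | (i, s) ∈ T} => (⟨(i, s), i.2⟩ : T) := by
      intro i j hij
      simpa [Subtype.ext_iff] using hij
    have hconst := hT.summable.comp_injective hinj
    have h0 := (summable_const_iff (β := {i | (i, s) ∈ T}) ((2 : ℝ) ^ (-D * (s.length : ℝ)))).1 hconst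
    exact (Real.rpow_pos_of_pos two_pos _).ne' h0
  have hfin' : (⋃ n ∈ Finset.range N, {i | (i, pre α n) ∈ T}).Finite :=
    Set.Finite.biUnion (Finset.finite_toSet _) fun n _ => hfin _
  obtain ⟨m, hm⟩ := hfin'.bddAbove
  refine ⟨m, fun i hi ⟨n, hn⟩ => ?_⟩
  have : i ≤ m := hm (Set.mem_biUnion (Finset.mem_coe.2 (Finset.mem_range.2 (hshort i n hn))) hn)
  omega

theorem SolovayRandom.chaitinRandom {U : List Bool →. List Bool} (hU : IsComputer U)
    {D : ℝ} (hDcomp : IsComputableReal D) (hD : 0 ≤ D) {α : ℕ → Bool}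
    (h : SolovayRandom D α) : ChaitinRandom U D α := by
  rw [chaitinRandom_iff]
  intro K
  obtain ⟨g, hg, hgD⟩ := hDcomp.exists_computable_approx hD
  -- Indexing by length makes level `i` concern only the prefix of length `i`. The `2` absorbs the
  -- error of `g`, so that every program of length at most `D * n + K` counts.
  let T : Set (ℕ × List Bool) :=
    {x | x.1 = x.2.length ∧ ∃ p, x.2 ∈ U p ∧ p.length ≤ g x.2.length + 2 + K}
  have hre : REPred fun x => x ∈ T := by
    obtain ⟨u, hu, -, -, huU⟩ := exists_stages hU.partrec
    have h1 : Computable fun y : (ℕ × List Bool) × (List Bool × ℕ) =>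
        decide (y.1.1 = y.1.2.length) :=
      Computable₂.comp (f := fun a b : ℕ => decide (a = b)) Primrec.eq.decide.to_comp
        (fst.comp fst) (list_length.comp (snd.comp fst))
    have h2 : Computable fun y : (ℕ × List Bool) × (List Bool × ℕ) =>
        decide (u y.2 = some y.1.2) :=
      Computable₂.comp (f := fun a b : Option (List Bool) => decide (a = b))
        Primrec.eq.decide.to_comp (hu.comp snd) (option_some.comp (snd.comp fst))
    have h3 : Computable fun y : (ℕ × List Bool) × (List Bool × ℕ) => g y.1.2.length + 2 + K :=
      (Primrec.nat_add.comp (Primrec.nat_add.comp .id (.const 2)) (.const K)).to_comp.comp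
        (hg.comp (list_length.comp (snd.comp fst)))
    have h4 : Computable fun y : (ℕ × List Bool) × (List Bool × ℕ) =>
        decide (y.2.1.length ≤ g y.1.2.length + 2 + K) :=
      Computable₂.comp (f := fun a b : ℕ => decide (a ≤ b)) Primrec.nat_le.decide.to_comp
        (list_length.comp (fst.comp snd)) h3
    refine (rePred_exists (Primrec.and.to_comp.comp h1 (Primrec.and.to_comp.comp h2 h4))).of_eq
      fun x => ?_
    simp only [Bool.and_eq_true, decide_eq_true_eq, T, Set.mem_ofPred_eq, huU, Option.mem_def]
    constructor
    · rintro ⟨⟨p, k⟩, hx, hk, hp⟩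
      exact ⟨hx, p, ⟨k, hk⟩, hp⟩
    · rintro ⟨hx, p, ⟨k, hk⟩, hp⟩
      exact ⟨(p, k), hx, hk, hp⟩
  have hsum : Summable fun x : T => (2 : ℝ) ^ (-D * ((x : ℕ × List Bool).2.length : ℝ)) := by
    choose q hq using fun x : T => x.2.2
    have hdom : ∀ x, q x ∈ U.Dom := fun x => Part.dom_iff_mem.2 ⟨_, (hq x).1⟩
    -- The chosen program determines the string, and the string's length determines the index.
    have hinj : Function.Injective fun x : T => (⟨q x, hdom x⟩ : U.Dom) := by
      intro x y hxy
      have hqq : q x = q y := congrArg Subtype.val hxy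
      have h2 : (x : ℕ × List Bool).2 = (y : ℕ × List Bool).2 :=
        Part.mem_unique (hq x).1 (hqq ▸ (hq y).1)
      refine Subtype.ext (Prod.ext ?_ h2)
      rw [x.2.1, y.2.1, h2]
    refine Summable.of_nonneg_of_le (fun x => by positivity) (fun x => ?_)
      ((hU.prefixFree.summable.comp_injective hinj).mul_left ((2 : ℝ) ^ ((2 + K : ℕ) : ℝ)))
    simp only [Function.comp_apply]
    rw [← two_rpow_neg_natCast, ← Real.rpow_add two_pos]
    refine Real.rpow_le_rpow_of_exponent_le one_le_two ?_
    have h1 : ((q x).length : ℝ) ≤ g (x : ℕ × List Bool).2.length + 2 + K := by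
      exact_mod_cast (hq x).2
    have h2 := (hgD (x : ℕ × List Bool).2.length).1
    push_cast
    linarith
  obtain ⟨m, hm⟩ := h T ⟨hre, hsum⟩
  filter_upwards [eventually_gt_atTop m] with n hn p hp
  by_contra hlt
  refine hm n hn ⟨n, ?_⟩
  refine ⟨(pre_length α n).symm, p, hp, ?_⟩
  have h1 : (p.length : ℝ) ≤ g n + 2 + K := by linarith [(hgD n).2]
  simp only [pre_length]
  exact_mod_cast h1

end DRandom

theorem mainTheorem6 (U : List Bool →. List Bool) (hU : DRandom.IsOptimalComputer U)
    (D : ℝ) (hDcomp : DRandom.IsComputableReal D) (hD : 0 ≤ D) (α : ℕ → Bool) :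
    DRandom.ChaitinRandom U D α ↔ DRandom.SolovayRandom D α :=
  ⟨fun h => h.solovayRandom hU hDcomp hD, fun h => h.chaitinRandom hU.isComputer hDcomp hD⟩
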